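/- Let $G=(V,E)$ be a finite, simple, undirected, connected graph with $n=|V|$ vertices. The lazy random walk on $G$ moves in discrete time from a vertex $u$ as follows: it stays at $u$ with probability $1/2$ and moves to each neighbour of $u$ with probability $1/(2\deg u)$ (if $n=1$, it stays at the only vertex). Let $t_{\mathrm{hit}}(u,v)$ be the expectation of the first time $t\ge 0$ at which the walk started at $u$ is at $v$, and let $t_{\mathrm{hit}}=\max_{u,v\in V}t_{\mathrm{hit}}(u,v)$, which is finite. The coalescing process is defined by $S_0=V$ (one walk on each vertex) and $$S_{t+1}=\{Y_v(t) : v\in S_t\},\qquad t\ge 0,$$ where the random variables $Y_v(t)$ ($v\in V$, $t\ge0$) are independent and $Y_v(t)$ is distributed as one step of the lazy random walk from $v$; thus walks that arrive at the same vertex at the same time merge, and $|S_t|$ is the number of walks left at time $t$. **Theorem.** There are universal constants $C,K>0$ (independent of $G$ and $n$) such that for every such graph $G$ and every integer $t\ge C\,t_{\mathrm{hit}}$, $$\Pr\left[\,|S_t|\le K\,(\log n)^3\,\right]\ \ge\ 1-\frac1n ,$$ where $\log$ is the natural logarithm. -/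

import Mathlib

open MeasureTheory
open scoped ENNReal

namespace CoalescingWalks

/-- Transition probability from `u` to `v` of the lazy random walk on `G`: stay with probability
`1/2`, and move to each neighbour with probability `1/(2 deg u)`. (A walk on an isolated vertex,
which in a connected graph exists only if the graph has one vertex, stays where it is.) -/
noncomputable def lazyProb {V : Type*} [Fintype V] [DecidableEq V] (G : SimpleGraph V)
    [DecidableRel G.Adj] (u v : V) : ℝ≥0∞ :=
  if G.degree u = 0 then (if v = u then 1 else 0)
  else if v = u then 2⁻¹
  else if G.Adj u v then (2 * (G.degree u : ℝ≥0∞))⁻¹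
  else 0

theorem sum_lazyProb {V : Type*} [Fintype V] [DecidableEq V] (G : SimpleGraph V)
    [DecidableRel G.Adj] (u : V) : ∑ v, lazyProb G u v = 1 := by
  by_cases h : G.degree u = 0
  · simp [lazyProb, h]
  · have h1 : ∀ v, lazyProb G u v = (if v = u then 2⁻¹ else 0) +
        (if G.Adj u v then (2 * (G.degree u : ℝ≥0∞))⁻¹ else 0) := by
      intro v
      by_cases hv : v = u
      · subst hv; simp [lazyProb, h]
      · simp [lazyProb, h, hv]
    simp_rw [h1]
    rw [Finset.sum_add_distrib, ← Finset.sum_filter (fun v => G.Adj u v),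
      ← SimpleGraph.neighborFinset_eq_filter, Finset.sum_const, SimpleGraph.card_neighborFinset_eq_degree,
      Finset.sum_ite_eq' Finset.univ u, if_pos (Finset.mem_univ u), nsmul_eq_mul,
      ENNReal.mul_inv (Or.inl (by simp)) (Or.inl (by simp)), mul_left_comm,
      ENNReal.mul_inv_cancel (by exact_mod_cast h) (by simp), mul_one, ENNReal.inv_two_add_inv_two]

/-- One step of the lazy random walk on `G` from the vertex `u`. -/
noncomputable def lazyStep {V : Type*} [Fintype V] [DecidableEq V] (G : SimpleGraph V)
    [DecidableRel G.Adj] (u : V) : PMF V :=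
  PMF.ofFintype (lazyProb G u) (sum_lazyProb G u)

/-- The law of a family of independent random variables `Y (t, v)`, for `t : ℕ` and `v : V`, where
`Y (t, v)` is one step of the lazy random walk from `v`. A sample point `ω : ℕ × V → V` tells, for
each time `t` and vertex `v`, where a walk that is on `v` at time `t` goes at time `t + 1`. -/
noncomputable def stepMeasure {V : Type*} [Fintype V] [DecidableEq V] [MeasurableSpace V]
    (G : SimpleGraph V) [DecidableRel G.Adj] : Measure (ℕ × V → V) :=
  Measure.infinitePi fun p : ℕ × V => (lazyStep G p.2).toMeasure

/-- The position at time `t` of the random walk which starts at `u`. -/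
def walk {V : Type*} (ω : ℕ × V → V) (u : V) : ℕ → V
  | 0 => u
  | t + 1 => ω (t, walk ω u t)

/-- The first time at which the walk from `u` is on `v` (`⊤` if this never happens). -/
noncomputable def hitTime {V : Type*} (ω : ℕ × V → V) (u v : V) : ℝ≥0∞ :=
  ⨅ (t : ℕ) (_ : walk ω u t = v), (t : ℝ≥0∞)

/-- The hitting time of the graph: the maximum over all pairs `u, v` of the expected time which the
lazy random walk from `u` needs to hit `v`. -/
noncomputable def tHit {V : Type*} [Fintype V] [DecidableEq V] [MeasurableSpace V]
    (G : SimpleGraph V) [DecidableRel G.Adj] : ℝ≥0∞ :=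
  ⨆ (u : V) (v : V), ∫⁻ ω, hitTime ω u v ∂(stepMeasure G)

/-- The coalescence process: the set of occupied vertices at time `t`, each of which carries exactly
one walk, if at time `0` there is one walk on each vertex of `S₀`. All walks make one step, and
walks which arrive at the same vertex merge. -/
def coalescing {V : Type*} [DecidableEq V] (ω : ℕ × V → V) (S₀ : Finset V) : ℕ → Finset V
  | 0 => S₀
  | t + 1 => (coalescing ω S₀ t).image fun v => ω (t, v)

end CoalescingWalks

/-!
The coalescing process is compared with `k` additional independent walks started from `b 1, …, b k`.
These walks never merge with one another, while every other walk is removed when it meets one of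
them. As long as each vertex occupied by the coalescing walks is occupied in the larger system,
the coalescing walk on a vertex can use the step of a walk of that system, so the larger system
dominates. Since the coalescing process starts with all vertices occupied, the starting points `b j`
are arbitrary, and more than `k` walks are left at time `t` only if one of the walks from the
vertices has avoided all the additional walks (`measure_lt_card_coalescing_le`).

The bound may therefore be averaged over `b`, and the additional walks be started independently
from the stationary distribution `π`; no mixing is needed. Given the path `h` of the walk from a
vertex, the `k` walks avoid it independently, each with probability `⟨1, Z₀ P Z₁ P ⋯ P Zₜ 1⟩_π`,
where `P` is the transition operator and `Zᵢ` is multiplication by the indicator of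
`{x | x ≠ h i}`. Laziness makes `P` positive semidefinite, so the Cauchy-Schwarz inequality for
`⟨f, P g⟩_π` bounds this by `l ^ t`, where `l` bounds the norm of every `Z P Z`
(`sum_prod_mul_avoidProb_le`). The expected hitting time `g` of a vertex `a` satisfies `g = 1 + P g`
off `a`, whence `l = 1 - 1 / tHit` will do (`form_flow_le`).

So more than `k` walks are left with probability at most `n (1 - 1 / tHit) ^ (t k)`. For `t ≥ tHit`
and `k = ⌈2 log n⌉` this is at most `1 / n`, which is stronger than what is asserted: already
`O(log n)` walks are left.
-/

set_option linter.unusedSectionVars false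

namespace CoalescingWalks
open ProbabilityTheory Function

/-! ### Quadratic forms -/

section Form

variable {V : Type*} [Fintype V]

/-- The bilinear form with matrix `c`. -/
def form (c : V → V → ℝ) (f g : V → ℝ) : ℝ := ∑ x, ∑ y, f x * c x y * g y

theorem form_sq_le [DecidableEq V] {c : V → V → ℝ} (hs : ∀ x y, c x y = c y x)
    (hp : ∀ f, 0 ≤ form c f f) (f g : V → ℝ) : form c f g ^ 2 ≤ form c f f * form c g g := by
  have h : ∀ f g, Matrix.toBilin' (Matrix.of c) f g = form c f g := fun f g => by
    simp [Matrix.toBilin'_apply, form]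
  have := LinearMap.BilinForm.apply_sq_le_of_symm (Matrix.toBilin' (Matrix.of c))
    (fun f => by rw [h]; exact hp f) ⟨fun f g => by
      simp only [h, RingHom.id_apply, form]
      rw [Finset.sum_comm]
      refine Finset.sum_congr rfl fun x _ => Finset.sum_congr rfl fun y _ => ?_
      rw [hs y x]; ring⟩ f g
  simpa only [h] using this

/-- A Dirichlet eigenvalue bound from a positive supersolution: if `g ≤ H` satisfies
`π + c g ≤ π g` away from `a`, then `⟨φ, c φ⟩ ≤ (1 - 1 / H) ‖φ‖²_π` for all `φ` which vanish at
`a`. -/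
theorem form_le_of_supersolution {c : V → V → ℝ} {π g φ : V → ℝ} {H : ℝ} {a : V}
    (hc : ∀ x y, 0 ≤ c x y) (hs : ∀ x y, c x y = c y x) (hπ : ∀ x, 0 ≤ π x)
    (hg0 : ∀ x, 0 ≤ g x) (hg1 : ∀ x, x ≠ a → 0 < g x) (hgH : ∀ x, g x ≤ H)
    (hg : ∀ x, x ≠ a → π x + ∑ y, c x y * g y ≤ π x * g x) (hφ : φ a = 0) :
    form c φ φ ≤ (1 - 1 / H) * ∑ x, π x * φ x ^ 2 := by
  have key : ∀ x y, φ x * c x y * φ y ≤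
      (c x y * (φ x ^ 2 * g y / g x) + c x y * (φ y ^ 2 * g x / g y)) / 2 := by
    intro x y
    by_cases hx : x = a
    · subst hx
      rw [hφ]
      have := mul_nonneg (hc x y) (div_nonneg (mul_nonneg (sq_nonneg (φ y)) (hg0 x)) (hg0 y))
      simp only [zero_mul]
      have h0 : (0 : ℝ) ^ 2 * g y / g x = 0 := by simp
      rw [h0]
      linarith
    by_cases hy : y = a
    · subst hy
      rw [hφ]
      have := mul_nonneg (hc x y) (div_nonneg (mul_nonneg (sq_nonneg (φ x)) (hg0 y)) (hg0 x))
      have h0 : (0 : ℝ) ^ 2 * g x / g y = 0 := by simp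
      rw [h0]
      linarith
    have hgx := hg1 x hx
    have hgy := hg1 y hy
    have h1 : 2 * (φ x * φ y) ≤ φ x ^ 2 * g y / g x + φ y ^ 2 * g x / g y := by
      have : φ x ^ 2 * g y / g x + φ y ^ 2 * g x / g y - 2 * (φ x * φ y) =
          (φ x * g y - φ y * g x) ^ 2 / (g x * g y) := by
        field_simp
        ring
      have h2 : 0 ≤ (φ x * g y - φ y * g x) ^ 2 / (g x * g y) := by positivity
      linarith
    nlinarith [mul_le_mul_of_nonneg_left h1 (hc x y)]
  have hsum : form c φ φ ≤ ∑ x, ∑ y, c x y * (φ x ^ 2 * g y / g x) := by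
    have h1 : form c φ φ ≤ ∑ x, ∑ y,
        (c x y * (φ x ^ 2 * g y / g x) + c x y * (φ y ^ 2 * g x / g y)) / 2 :=
      Finset.sum_le_sum fun x _ => Finset.sum_le_sum fun y _ => key x y
    have h2 : ∑ x, ∑ y, c x y * (φ y ^ 2 * g x / g y) =
        ∑ x, ∑ y, c x y * (φ x ^ 2 * g y / g x) := by
      rw [Finset.sum_comm]
      exact Finset.sum_congr rfl fun x _ => Finset.sum_congr rfl fun y _ => by rw [hs y x]
    simp_rw [← Finset.sum_div, Finset.sum_add_distrib] at h1
    rw [h2] at h1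
    linarith
  refine hsum.trans ?_
  rw [Finset.mul_sum]
  refine Finset.sum_le_sum fun x _ => ?_
  by_cases hx : x = a
  · subst hx; simp [hφ]
  have hgx := hg1 x hx
  calc ∑ y, c x y * (φ x ^ 2 * g y / g x) = φ x ^ 2 / g x * ∑ y, c x y * g y := by
        rw [Finset.mul_sum]
        exact Finset.sum_congr rfl fun y _ => by ring
    _ ≤ φ x ^ 2 / g x * (π x * g x - π x) := by
        gcongr
        linarith [hg x hx]
    _ = (1 - 1 / g x) * (π x * φ x ^ 2) := by field_simp
    _ ≤ (1 - 1 / H) * (π x * φ x ^ 2) := by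
        have := hgH x
        have := hπ x
        gcongr

end Form

variable {V : Type*} [Fintype V] [DecidableEq V] [MeasurableSpace V] [DiscreteMeasurableSpace V]
  (G : SimpleGraph V) [DecidableRel G.Adj]

/-! ### Independent steps of several walks -/

/-- The joint law of one independent step of each of the walks `i : ι`, of which the `i`-th is at
`x i`. Several walks may be at the same vertex; they still step independently. -/
noncomputable def jointStep {ι : Type*} [Fintype ι] (x : ι → V) : Measure (ι → V) :=
  Measure.pi fun i => (lazyStep G (x i)).toMeasure

instance {ι : Type*} [Fintype ι] (x : ι → V) : IsProbabilityMeasure (jointStep G x) := by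
  unfold jointStep; infer_instance

instance : IsProbabilityMeasure (stepMeasure G) := by
  unfold stepMeasure; infer_instance

theorem lintegral_jointStep {ι : Type*} [Fintype ι] [DecidableEq ι] (x : ι → V)
    (φ : (ι → V) → ℝ≥0∞) :
    ∫⁻ z, φ z ∂(jointStep G x) = ∑ z, (∏ i, lazyProb G (x i) (z i)) * φ z := by
  rw [lintegral_fintype]
  refine Finset.sum_congr rfl fun z _ => ?_
  rw [jointStep, Measure.pi_singleton, mul_comm]
  congr 1
  refine Finset.prod_congr rfl fun i _ => ?_
  rw [PMF.toMeasure_apply_singleton _ _ (measurableSet_singleton _)]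
  rfl

/-- Selecting distinct walks from an independent family gives an independent family. -/
theorem jointStep_map_comp {ι κ : Type*} [Fintype ι] [Fintype κ] (x : κ → V) {j : ι → κ}
    (hj : Injective j) : (jointStep G x).map (fun z => z ∘ j) = jointStep G (x ∘ j) := by
  have h : iIndepFun (fun (i : κ) (z : κ → V) => z i) (jointStep G x) :=
    iIndepFun_pi (X := fun _ => id) fun i => aemeasurable_id
  have h2 := (iIndepFun_iff_map_fun_eq_pi_map
    (fun i => (measurable_pi_apply (j i)).aemeasurable)).1 (h.precomp hj)
  refine h2.trans ?_
  unfold jointStep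
  congr 1
  funext i
  exact (measurePreserving_eval (fun i => (lazyStep G (x i)).toMeasure) (j i)).map_eq

theorem lintegral_jointStep_comp {ι κ : Type*} [Fintype ι] [Fintype κ] (x : κ → V) {j : ι → κ}
    (hj : Injective j) (φ : (ι → V) → ℝ≥0∞) :
    ∫⁻ z, φ (z ∘ j) ∂(jointStep G x) = ∫⁻ z, φ z ∂(jointStep G (x ∘ j)) := by
  rw [← jointStep_map_comp G x hj, lintegral_map (measurable_of_finite _) (measurable_of_finite _)]

theorem lintegral_jointStep_apply {ι : Type*} [Fintype ι] (x : ι → V) (i : ι) (φ : V → ℝ≥0∞) :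
    ∫⁻ z, φ (z i) ∂(jointStep G x) = ∑ w, lazyProb G (x i) w * φ w := by
  have h := lintegral_jointStep_comp G x (j := fun _ : Unit => i) (injective_of_subsingleton _)
    (fun z => φ (z ()))
  simp only [comp_apply] at h
  rw [h, lintegral_jointStep, ← (Equiv.funUnique Unit V).symm.sum_comp]
  simp [Equiv.funUnique]

/-! ### Processes driven by the random steps -/

/-- The process with values in `σ` which starts at `z` and is updated by `F` with the steps
`v ↦ ω (t, v)` made at time `t`. -/
def driven {V σ : Type*} (F : σ → (V → V) → σ) (z : σ) (ω : ℕ × V → V) : ℕ → σ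
  | 0 => z
  | t + 1 => F (driven F z ω t) fun v => ω (t, v)

/-- The Markov operator of a driven process: the expectation of `φ` after one step. -/
noncomputable def transfer {σ : Type*} (F : σ → (V → V) → σ) (φ : σ → ℝ≥0∞) (z : σ) : ℝ≥0∞ :=
  ∫⁻ y, φ (F z y) ∂(jointStep G id)

theorem driven_congr {V σ : Type*} (F : σ → (V → V) → σ) (z : σ) {ω ω' : ℕ × V → V} (t : ℕ)
    (h : ∀ s < t, ∀ v, ω (s, v) = ω' (s, v)) : driven F z ω t = driven F z ω' t := by
  induction t with
  | zero => rfl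
  | succ t ih =>
    simp only [driven]
    rw [ih fun s hs => h s (hs.trans t.lt_succ_self), funext fun v => h t t.lt_succ_self v]

theorem iIndepFun_steps : iIndepFun (fun (p : ℕ × V) (ω : ℕ × V → V) => ω p) (stepMeasure G) :=
  iIndepFun_infinitePi (X := fun _ => id) fun _ => measurable_id

theorem map_steps (t : ℕ) :
    (stepMeasure G).map (fun ω v => ω (t, v)) = jointStep G id := by
  have h := (iIndepFun_steps G).precomp (g := fun v : V => (t, v)) (Prod.mk_right_injective t)
  have h2 := (iIndepFun_iff_map_fun_eq_pi_map
    (fun v => (measurable_pi_apply (t, v)).aemeasurable)).1 h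
  refine h2.trans ?_
  unfold jointStep
  congr 1
  funext v
  exact Measure.infinitePi_map_eval (fun p : ℕ × V => (lazyStep G p.2).toMeasure) (t, v)

/-- Extension of finitely many steps, in which all steps not given stand still. -/
def extendSteps {V : Type*} [DecidableEq V] (S : Finset (ℕ × V)) (f : S → V) (p : ℕ × V) : V :=
  if h : p ∈ S then f ⟨p, h⟩ else p.2

theorem driven_eq_extendSteps {σ : Type*} (F : σ → (V → V) → σ) (z : σ) (t : ℕ) (ω : ℕ × V → V) :
    driven F z ω t = driven F z (extendSteps (Finset.range t ×ˢ Finset.univ)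
      fun p => ω p) t := by
  refine driven_congr F z t fun s hs v => ?_
  simp [extendSteps, hs]

theorem measurable_driven {σ : Type*} [MeasurableSpace σ] (F : σ → (V → V) → σ) (z : σ) (t : ℕ) :
    Measurable fun ω => driven F z ω t := by
  rw [funext fun ω => driven_eq_extendSteps F z t ω]
  exact (measurable_of_finite fun f => driven F z
    (extendSteps (Finset.range t ×ˢ (Finset.univ : Finset V)) f) t).comp
    (measurable_pi_lambda _ fun p => measurable_pi_apply _)

theorem indepFun_driven_steps {σ : Type*} [MeasurableSpace σ] (F : σ → (V → V) → σ) (z : σ)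
    (t : ℕ) :
    IndepFun (fun ω => driven F z ω t) (fun ω v => ω (t, v)) (stepMeasure G) := by
  have h := (iIndepFun_steps G).indepFun_finset (Finset.range t ×ˢ (Finset.univ : Finset V))
    ({t} ×ˢ (Finset.univ : Finset V)) (by
      rw [Finset.disjoint_left]
      simp only [Finset.mem_product, Finset.mem_range, Finset.mem_singleton]
      omega) (fun p => measurable_pi_apply p)
  have h2 := h.comp (φ := fun f => driven F z
    (extendSteps (Finset.range t ×ˢ (Finset.univ : Finset V)) f) t)
    (ψ := fun f (v : V) => f ⟨(t, v), by simp⟩) (measurable_of_finite _) (measurable_of_finite _)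
  rw [funext fun ω => driven_eq_extendSteps F z t ω]
  exact h2

theorem lintegral_driven_succ {σ : Type*} [Finite σ] (F : σ → (V → V) → σ) (z : σ)
    (φ : σ → ℝ≥0∞) (t : ℕ) :
    ∫⁻ ω, φ (driven F z ω (t + 1)) ∂(stepMeasure G) =
      ∫⁻ ω, transfer G F φ (driven F z ω t) ∂(stepMeasure G) := by
  let _ : MeasurableSpace σ := ⊤
  have hY : Measurable fun (ω : ℕ × V → V) (v : V) => ω (t, v) :=
    measurable_pi_lambda _ fun v => measurable_pi_apply _
  have hZ := measurable_driven F z t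
  have h := (indepFun_iff_map_prod_eq_prod_map_map hZ.aemeasurable hY.aemeasurable).1
    (indepFun_driven_steps G F z t)
  calc ∫⁻ ω, φ (driven F z ω (t + 1)) ∂(stepMeasure G)
      = ∫⁻ q, φ (F q.1 q.2) ∂((stepMeasure G).map
          fun ω => (driven F z ω t, fun v => ω (t, v))) := by
        rw [lintegral_map (measurable_of_finite _) (hZ.prodMk hY)]; rfl
    _ = ∫⁻ x, ∫⁻ y, φ (F x y) ∂(jointStep G id)
          ∂((stepMeasure G).map fun ω => driven F z ω t) := by
        rw [h, map_steps, lintegral_prod _ (measurable_of_finite _).aemeasurable]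
    _ = _ := by rw [lintegral_map (measurable_of_finite _) hZ]; rfl

theorem lintegral_driven {σ : Type*} [Finite σ] (F : σ → (V → V) → σ) (z : σ)
    (φ : σ → ℝ≥0∞) (t : ℕ) :
    ∫⁻ ω, φ (driven F z ω t) ∂(stepMeasure G) = (transfer G F)^[t] φ z := by
  induction t generalizing φ with
  | zero => simp [driven]
  | succ t ih => rw [lintegral_driven_succ, ih, iterate_succ_apply]

/-! ### Domination by independent walks which are never killed -/

variable {κ : Type*} [Fintype κ] [DecidableEq κ]

/-- The probability that the walk from `a` meets none of the independent walks from `b j`, `j : κ`,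
at the times `0, …, s`. -/
noncomputable def avoidProb : ℕ → V → (κ → V) → ℝ≥0∞
  | 0, a, b => if ∃ j, b j = a then 0 else 1
  | s + 1, a, b => if ∃ j, b j = a then 0 else
      ∑ a', lazyProb G a a' * ∑ b', (∏ j, lazyProb G (b j) (b' j)) * avoidProb s a' b'

theorem avoidProb_succ (s : ℕ) {a : V} {b : κ → V} (h : ¬ ∃ j, b j = a) :
    avoidProb G (s + 1) a b =
      ∫⁻ z : V ⊕ κ → V, avoidProb G s (z (Sum.inl a)) (z ∘ Sum.inr)
        ∂(jointStep G (Sum.elim id b)) := by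
  have hj : Injective fun o : Option κ => o.elim (Sum.inl a : V ⊕ κ) Sum.inr := by
    rintro (_ | i) (_ | i') <;> simp
  have h1 := lintegral_jointStep_comp G (Sum.elim id b) hj
    (fun z => avoidProb G s (z none) (z ∘ some))
  rw [avoidProb, if_neg h]
  refine Eq.trans ?_ h1.symm
  rw [lintegral_jointStep, ← (Equiv.piOptionEquivProd (β := fun _ : Option κ => V)).symm.sum_comp,
    Fintype.sum_prod_type]
  refine Finset.sum_congr rfl fun a' _ => ?_
  rw [Finset.mul_sum]
  refine Finset.sum_congr rfl fun b' _ => ?_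
  rw [Fintype.prod_option, ← mul_assoc]
  rfl

theorem transfer_mono_set {φ : Finset V → ℝ≥0∞} (hφ : Monotone φ) :
    Monotone (transfer G (fun (S : Finset V) y => S.image y) φ) := fun _ _ h =>
  lintegral_mono fun _ => hφ (Finset.image_subset_image h)

/-- The process of coalescing walks from `D ∪ range b` is dominated by the one in which the walks
from `b j` step independently even when they share a vertex, and only the other walks coalesce with
one another and are removed on meeting one of the walks from `b`. Hence the number of
occupied vertices exceeds the number `card κ` of walks from `b` only if one of the walks from `D`
avoids all of these. -/
theorem iterate_transfer_le_sum_avoidProb (s : ℕ) (D : Finset V) (b : κ → V) :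
    (transfer G fun (S : Finset V) y => S.image y)^[s]
        (fun S => if Fintype.card κ < S.card then 1 else 0) (D ∪ Finset.univ.image b) ≤
      ∑ a ∈ D, avoidProb G s a b := by
  set F : Finset V → (V → V) → Finset V := fun S y => S.image y
  set φ : Finset V → ℝ≥0∞ := fun S => if Fintype.card κ < S.card then 1 else 0
  have hmono : ∀ s, Monotone ((transfer G F)^[s] φ) := by
    intro s
    induction s with
    | zero =>
      intro S T h
      simp only [iterate_zero, id, φ]
      split_ifs with h1 h2
      · exact le_rfl
      · exact absurd (h1.trans_le (Finset.card_le_card h)) h2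
      · exact zero_le
      · exact le_rfl
    | succ s ih => rw [iterate_succ_apply']; exact transfer_mono_set G ih
  induction s generalizing D b with
  | zero =>
    simp only [iterate_zero, id, φ]
    split_ifs with h
    · obtain ⟨a, haD, ha⟩ : ∃ a ∈ D, ¬ ∃ j, b j = a := by
        by_contra! hcon
        refine h.not_ge ((Finset.card_le_card (t := Finset.univ.image b) ?_).trans
          Finset.card_image_le)
        refine Finset.union_subset (fun a ha => ?_) subset_rfl
        simpa using hcon a ha
      refine le_trans ?_ (Finset.single_le_sum (fun _ _ => zero_le) haD)
      rw [avoidProb, if_neg ha]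
    · exact zero_le
  | succ s ih =>
    -- Each vertex of `range b` gets the step of one of the walks standing on it.
    let r : V → V ⊕ κ := fun v => if h : ∃ j, b j = v then Sum.inr h.choose else Sum.inl v
    have hr : (Sum.elim id b : V ⊕ κ → V) ∘ r = id := by
      funext v
      simp only [r, comp_apply]
      split_ifs with h
      · exact h.choose_spec
      · rfl
    have hrinj : Injective r := fun v w h => by
      have := congrArg (Sum.elim id b) h
      rwa [← comp_apply (f := Sum.elim id b), ← comp_apply (f := Sum.elim id b), hr] at this
    rw [iterate_succ_apply']
    set D' := D.filter fun a => ¬ ∃ j, b j = a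
    calc transfer G F ((transfer G F)^[s] φ) (D ∪ Finset.univ.image b)
        = ∫⁻ z, (transfer G F)^[s] φ ((D ∪ Finset.univ.image b).image (z ∘ r))
            ∂(jointStep G (Sum.elim id b)) := by
          rw [lintegral_jointStep_comp G (Sum.elim id b) hrinj
            (fun y => (transfer G F)^[s] φ ((D ∪ Finset.univ.image b).image y)), hr]
          rfl
      _ ≤ ∫⁻ z, (transfer G F)^[s] φ (D'.image (z ∘ Sum.inl) ∪ Finset.univ.image (z ∘ Sum.inr))
            ∂(jointStep G (Sum.elim id b)) := by
          refine lintegral_mono fun z => hmono s ?_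
          intro c hc
          obtain ⟨v, hv, rfl⟩ := Finset.mem_image.1 hc
          by_cases h : ∃ j, b j = v
          · refine Finset.mem_union_right _ (Finset.mem_image.2 ⟨h.choose, Finset.mem_univ _, ?_⟩)
            simp [r, h]
          · refine Finset.mem_union_left _ (Finset.mem_image.2 ⟨v, ?_, by simp [r, h]⟩)
            refine Finset.mem_filter.2 ⟨?_, h⟩
            rcases Finset.mem_union.1 hv with h1 | h1
            · exact h1
            · exact absurd (by simpa using h1) h
      _ ≤ ∫⁻ z, ∑ a ∈ D', avoidProb G s (z (Sum.inl a)) (z ∘ Sum.inr)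
            ∂(jointStep G (Sum.elim id b)) :=
          lintegral_mono fun z => (ih _ _).trans
            (Finset.sum_image_le_of_nonneg fun _ _ => zero_le)
      _ = ∑ a ∈ D', avoidProb G (s + 1) a b := by
          rw [lintegral_finsetSum _ fun _ _ => measurable_of_finite _]
          refine Finset.sum_congr rfl fun a ha => ?_
          rw [avoidProb_succ G s (Finset.mem_filter.1 ha).2]
      _ ≤ ∑ a ∈ D, avoidProb G (s + 1) a b :=
          Finset.sum_le_sum_of_subset (Finset.filter_subset _ _)

theorem coalescing_eq_driven {V : Type*} [DecidableEq V] (ω : ℕ × V → V) (S : Finset V) (t : ℕ) :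
    coalescing ω S t = driven (fun (S : Finset V) y => S.image y) S ω t := by
  induction t with
  | zero => rfl
  | succ t ih => simp only [coalescing, driven, ih]

theorem measure_lt_card_coalescing_le (k t : ℕ) (b : Fin k → V) :
    stepMeasure G {ω | k < (coalescing ω Finset.univ t).card} ≤ ∑ a, avoidProb G t a b := by
  let _ : MeasurableSpace (Finset V) := ⊤
  have hm : MeasurableSet {ω : ℕ × V → V | k < (coalescing ω Finset.univ t).card} := by
    simp_rw [coalescing_eq_driven]
    have h := measurable_driven (fun (S : Finset V) (y : V → V) => S.image y) Finset.univ t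
    exact h (show MeasurableSet {S : Finset V | k < S.card} from trivial)
  have h := iterate_transfer_le_sum_avoidProb G t Finset.univ b
  rw [← lintegral_indicator_one hm]
  refine le_trans (le_of_eq ?_) h
  have hu : Finset.univ ∪ Finset.univ.image b = Finset.univ :=
    Finset.union_eq_left.2 (Finset.subset_univ _)
  rw [hu, ← lintegral_driven]
  refine lintegral_congr fun ω => ?_
  simp [Set.indicator_apply, coalescing_eq_driven]

/-! ### Hitting times -/

/-- The update rule of the walk which stops for good at the vertex `v`. -/
def stopAt {V : Type*} [DecidableEq V] (v w : V) (y : V → V) : V := if w = v then v else y w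

theorem driven_stopAt_eq {V : Type*} [DecidableEq V] (ω : ℕ × V → V) (u v : V) (t : ℕ) :
    driven (stopAt v) u ω t = if ∃ s ≤ t, walk ω u s = v then v else walk ω u t := by
  induction t with
  | zero => by_cases h : u = v <;> simp [driven, walk, h]
  | succ t ih =>
    simp only [driven, ih, stopAt]
    by_cases h : ∃ s ≤ t, walk ω u s = v
    · have h' : ∃ s ≤ t + 1, walk ω u s = v := h.imp fun s hs => ⟨hs.1.trans t.le_succ, hs.2⟩
      simp [h, h']
    · rw [if_neg h, if_neg fun hv => h ⟨t, le_rfl, hv⟩]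
      split_ifs with h'
      · obtain ⟨s, hs, hsv⟩ := h'
        obtain rfl : s = t + 1 := by
          by_contra hne
          exact h ⟨s, by omega, hsv⟩
        exact hsv
      · rfl

theorem driven_stopAt_eq_iff {V : Type*} [DecidableEq V] (ω : ℕ × V → V) (u v : V) (t : ℕ) :
    driven (stopAt v) u ω t = v ↔ ∃ s ≤ t, walk ω u s = v := by
  rw [driven_stopAt_eq]
  split_ifs with h
  · simp [h]
  · exact ⟨fun hv => ⟨t, le_rfl, hv⟩, fun h' => absurd h' h⟩

/-- The hitting time is the number of times at which the stopped walk is not yet on the target. -/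
theorem hitTime_eq_tsum {V : Type*} [DecidableEq V] (ω : ℕ × V → V) (u v : V) :
    hitTime ω u v = ∑' t, if driven (stopAt v) u ω t = v then (0 : ℝ≥0∞) else 1 := by
  simp_rw [driven_stopAt_eq_iff]
  by_cases h : ∃ t, walk ω u t = v
  · have h1 : hitTime ω u v = (Nat.find h : ℝ≥0∞) :=
      le_antisymm (iInf₂_le (f := fun t (_ : walk ω u t = v) => (t : ℝ≥0∞)) _ (Nat.find_spec h))
        (le_iInf₂ fun t ht => by exact_mod_cast Nat.find_min' h ht)
    have h2 : ∀ t, (∃ s ≤ t, walk ω u s = v) ↔ Nat.find h ≤ t := fun t => by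
      rw [Nat.find_le_iff]
    simp_rw [h1, h2]
    rw [tsum_eq_sum (s := Finset.range (Nat.find h))
      (fun t ht => if_pos (by simpa using ht)),
      Finset.sum_congr rfl fun t ht => if_neg (by simpa using ht)]
    simp
  · have h1 : hitTime ω u v = ⊤ := by
      simp only [hitTime, iInf_eq_top]
      exact fun t ht => absurd ⟨t, ht⟩ h
    have h2 : ∀ t, ¬ ∃ s ≤ t, walk ω u s = v := fun t ht => h (ht.imp fun _ hs => hs.2)
    simp [h1, h2]

/-- The expected time in which the walk from `u` hits `v`. -/
noncomputable def expHit (u v : V) : ℝ≥0∞ := ∫⁻ ω, hitTime ω u v ∂(stepMeasure G)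

theorem expHit_le_tHit (u v : V) : expHit G u v ≤ tHit G :=
  le_iSup₂ (f := fun u v : V => ∫⁻ ω, hitTime ω u v ∂(stepMeasure G)) u v

theorem expHit_eq_tsum_lintegral (u v : V) :
    expHit G u v =
      ∑' t, ∫⁻ ω, (if driven (stopAt v) u ω t = v then 0 else 1) ∂(stepMeasure G) := by
  simp_rw [expHit, hitTime_eq_tsum]
  exact lintegral_tsum fun t => ((measurable_of_finite fun w : V => if w = v then (0 : ℝ≥0∞) else
    1).comp (measurable_driven (stopAt v) u t)).aemeasurable

theorem expHit_eq_tsum (u v : V) :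
    expHit G u v = ∑' t, (transfer G (stopAt v))^[t] (fun w => if w = v then 0 else 1) u := by
  rw [expHit_eq_tsum_lintegral]
  exact tsum_congr fun t => lintegral_driven G (stopAt v) u (fun w => if w = v then 0 else 1) t

theorem transfer_stopAt_self (v : V) (φ : V → ℝ≥0∞) : transfer G (stopAt v) φ v = φ v := by
  simp [transfer, stopAt]

theorem transfer_stopAt_of_ne {u v : V} (h : u ≠ v) (φ : V → ℝ≥0∞) :
    transfer G (stopAt v) φ u = ∑ w, lazyProb G u w * φ w := by
  simp only [transfer, stopAt, if_neg h]
  exact lintegral_jointStep_apply G id u φ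

theorem expHit_self (v : V) : expHit G v v = 0 := by
  rw [expHit_eq_tsum, ENNReal.tsum_eq_zero]
  intro t
  induction t with
  | zero => simp
  | succ t ih => rw [iterate_succ_apply', transfer_stopAt_self, ih]

theorem expHit_of_ne {u v : V} (h : u ≠ v) :
    expHit G u v = 1 + ∑ w, lazyProb G u w * expHit G w v := by
  rw [expHit_eq_tsum, tsum_eq_zero_add' ENNReal.summable]
  simp_rw [iterate_succ_apply', transfer_stopAt_of_ne G h, expHit_eq_tsum]
  rw [Summable.tsum_finsetSum fun _ _ => ENNReal.summable]
  simp [h, ENNReal.tsum_mul_left]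

theorem exists_adj_dist_eq {V : Type*} {G : SimpleGraph V} (hG : G.Connected) {u v : V}
    (h : u ≠ v) : ∃ w, G.Adj u w ∧ G.dist u v = G.dist w v + 1 := by
  obtain ⟨p, hp⟩ := hG.exists_walk_length_eq_dist u v
  cases p with
  | nil => exact absurd rfl h
  | @cons _ w _ hadj q =>
    refine ⟨w, hadj, le_antisymm ?_ ?_⟩
    · have h1 := hG.dist_triangle (u := u) (v := w) (w := v)
      rw [SimpleGraph.dist_eq_one_iff_adj.2 hadj] at h1
      omega
    · have := SimpleGraph.dist_le q
      rw [SimpleGraph.Walk.length_cons] at hp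
      omega

/-- With `q = (4n)⁻¹`, the function `u ↦ q ^ dist u v` at least doubles in mean at each step before
`v` is hit. As it takes values in an interval `[c, 1]` with `c > 0`, the expected number of these
steps is at most `c⁻¹`. -/
theorem expHit_ne_top (hG : G.Connected) (u v : V) : expHit G u v ≠ ⊤ := by
  set n : ℝ≥0∞ := (Fintype.card V : ℝ≥0∞)
  set q : ℝ≥0∞ := (4 * n)⁻¹
  have hn1 : 1 ≤ n := by
    have : Nonempty V := ⟨u⟩
    simp only [n]
    exact_mod_cast Fintype.card_pos (α := V)
  have hnt : n ≠ ⊤ := ENNReal.natCast_ne_top _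
  have hq0 : q ≠ 0 := ENNReal.inv_ne_zero.2 (ENNReal.mul_ne_top (by simp) hnt)
  have hq1 : q ≤ 1 := ENNReal.inv_le_one.2 (hn1.trans (le_mul_of_one_le_left' (by norm_num)))
  set f : V → ℝ≥0∞ := fun w => q ^ G.dist w v
  have hf1 : ∀ w, f w ≤ 1 := fun w => pow_le_one' hq1 _
  set c : ℝ≥0∞ := q ^ ∑ w, G.dist w v
  have hc0 : c ≠ 0 := pow_ne_zero _ hq0
  have hcf : ∀ w, c ≤ f w := fun w => pow_le_pow_right_of_le_one' hq1
    (Finset.single_le_sum (f := fun w => G.dist w v) (fun _ _ => Nat.zero_le _) (Finset.mem_univ w))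
  have hstep : ∀ w, c * (if w = v then 0 else 1) + f w ≤ transfer G (stopAt v) f w := by
    intro w
    by_cases hw : w = v
    · subst hw; simp [transfer_stopAt_self]
    · obtain ⟨x, hadj, hd⟩ := exists_adj_dist_eq hG hw
      have hdeg : G.degree w ≠ 0 := (G.degree_pos_iff_exists_adj w).2 ⟨x, hadj⟩ |>.ne'
      have hp : 2 * q ≤ lazyProb G w x := by
        have hdn : (G.degree w : ℝ≥0∞) ≤ n := by
          simp only [n]; exact_mod_cast (G.degree_lt_card_verts w).le
        rw [lazyProb, if_neg hdeg, if_neg hadj.ne', if_pos hadj]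
        have h2 : 2 * q = (2 * n)⁻¹ := by
          have : (4 : ℝ≥0∞) = 2 * 2 := by norm_num
          simp only [q]
          rw [this, mul_assoc, ENNReal.mul_inv (Or.inl (by simp)) (Or.inl (by simp)), ← mul_assoc,
            ENNReal.mul_inv_cancel (by simp) (by simp), one_mul]
        rw [h2]
        exact ENNReal.inv_le_inv.2 (by gcongr)
      rw [transfer_stopAt_of_ne G hw, if_neg hw, mul_one]
      calc c + f w ≤ f w + f w := by gcongr; exact hcf w
        _ = 2 * q * f x := by simp only [f, hd, pow_succ]; ring
        _ ≤ lazyProb G w x * f x := by gcongr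
        _ ≤ _ := Finset.single_le_sum (f := fun x => lazyProb G w x * f x) (fun _ _ => zero_le)
            (Finset.mem_univ x)
  have hsum : ∀ N, c * ∑ t ∈ Finset.range N,
      ∫⁻ ω, (if driven (stopAt v) u ω t = v then 0 else 1) ∂(stepMeasure G) + f u ≤
      ∫⁻ ω, f (driven (stopAt v) u ω N) ∂(stepMeasure G) := by
    intro N
    induction N with
    | zero => simp [driven]
    | succ N ih =>
      have hm : Measurable fun ω => (if driven (stopAt v) u ω N = v then (0 : ℝ≥0∞) else 1) :=
        (measurable_of_finite fun w : V => if w = v then (0 : ℝ≥0∞) else 1).comp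
          (measurable_driven (stopAt v) u N)
      rw [lintegral_driven_succ, Finset.sum_range_succ, mul_add, add_right_comm]
      refine (add_le_add_left ih _).trans ?_
      rw [← lintegral_const_mul _ hm, add_comm, ← lintegral_add_left (hm.const_mul c)]
      exact lintegral_mono fun ω => hstep _
  have hle : expHit G u v ≤ c⁻¹ := by
    rw [expHit_eq_tsum_lintegral, ENNReal.tsum_eq_iSup_nat]
    refine iSup_le fun N => ?_
    rw [ENNReal.le_inv_iff_mul_le, mul_comm]
    calc _ ≤ _ := le_self_add
      _ ≤ _ := hsum N
      _ ≤ ∫⁻ ω, 1 ∂(stepMeasure G) := lintegral_mono fun ω => hf1 _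
      _ = 1 := by simp
  exact ne_top_of_le_ne_top (ENNReal.inv_ne_top.2 hc0) hle

theorem tHit_ne_top (hG : G.Connected) : tHit G ≠ ⊤ := by
  have h : tHit G ≤ ∑ u, ∑ v, expHit G u v :=
    iSup₂_le fun u v => (Finset.single_le_sum (f := fun v => expHit G u v) (fun _ _ => zero_le)
      (Finset.mem_univ v)).trans (Finset.single_le_sum (f := fun u => ∑ v, expHit G u v)
        (fun _ _ => zero_le) (Finset.mem_univ u))
  exact ne_top_of_le_ne_top
    (ENNReal.sum_ne_top.2 fun u _ => ENNReal.sum_ne_top.2 fun v _ => expHit_ne_top G hG u v) h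

/-! ### The stationary distribution -/

theorem lazyProb_ne_top (u v : V) : lazyProb G u v ≠ ⊤ :=
  ((lazyStep G u).apply_ne_top v)

theorem sum_toReal_lazyProb (u : V) : ∑ v, (lazyProb G u v).toReal = 1 := by
  rw [← ENNReal.toReal_sum fun v _ => lazyProb_ne_top G u v, sum_lazyProb, ENNReal.toReal_one]

/-- The stationary distribution of the lazy random walk. -/
noncomputable def stat (u : V) : ℝ := (G.degree u : ℝ) / ∑ w, (G.degree w : ℝ)

/-- The probability that the stationary lazy random walk goes from `u` to `v` in its first step. -/
noncomputable def flow (u v : V) : ℝ := stat G u * (lazyProb G u v).toReal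

theorem flow_eq (u v : V) : flow G u v = ((if u = v then (G.degree u : ℝ) else 0) +
    (if G.Adj u v then 1 else 0)) / 2 / ∑ w, (G.degree w : ℝ) := by
  rw [flow, stat, div_mul_eq_mul_div]
  congr 1
  by_cases h : G.degree u = 0
  · have h1 : ¬ G.Adj u v := fun hadj =>
      ((G.degree_pos_iff_exists_adj u).2 ⟨v, hadj⟩).ne' h
    simp [h, h1]
  · by_cases huv : u = v
    · subst huv
      simp [lazyProb, h]
      ring
    · rw [lazyProb, if_neg h, if_neg fun h' => huv h'.symm, if_neg huv]
      split_ifs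
      · have : (G.degree u : ℝ) ≠ 0 := by exact_mod_cast h
        simp [ENNReal.toReal_inv]
        field_simp
      · simp

theorem stat_nonneg (u : V) : 0 ≤ stat G u := by unfold stat; positivity

theorem flow_nonneg (u v : V) : 0 ≤ flow G u v := mul_nonneg (stat_nonneg G u) ENNReal.toReal_nonneg

theorem flow_comm (u v : V) : flow G u v = flow G v u := by
  rw [flow_eq, flow_eq]
  by_cases h : u = v
  · subst h; rfl
  · simp [h, Ne.symm h, G.adj_comm u v]

theorem sum_flow (u : V) : ∑ v, flow G u v = stat G u := by
  simp only [flow]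
  rw [← Finset.mul_sum, sum_toReal_lazyProb, mul_one]

/-- Laziness makes the transition operator positive semidefinite: the form is
`∑ (f x + f y) ^ 2` over the edges, up to a positive factor. -/
theorem form_flow_nonneg (f : V → ℝ) : 0 ≤ form (flow G) f f := by
  have h : form (flow G) f f = (∑ x, ∑ y, if G.Adj x y then (f x + f y) ^ 2 else 0) / 4 /
      ∑ w, (G.degree w : ℝ) := by
    have hd : ∀ x, (G.degree x : ℝ) = ∑ y, if G.Adj x y then (1 : ℝ) else 0 := fun x => by
      rw [Finset.sum_boole, ← SimpleGraph.neighborFinset_eq_filter,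
        SimpleGraph.card_neighborFinset_eq_degree]
    have e1 : ∀ x, ∑ y, f x * flow G x y * f y =
        ((G.degree x : ℝ) * f x ^ 2 + ∑ y, if G.Adj x y then f x * f y else 0) / 2 /
          ∑ w, (G.degree w : ℝ) := by
      intro x
      simp_rw [flow_eq]
      have : ∀ y, f x * (((if x = y then (G.degree x : ℝ) else 0) +
          (if G.Adj x y then 1 else 0)) / 2 / ∑ w, (G.degree w : ℝ)) * f y =
          ((if x = y then (G.degree x : ℝ) * f x * f y else 0) +
          (if G.Adj x y then f x * f y else 0)) / 2 / ∑ w, (G.degree w : ℝ) := by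
        intro y
        split_ifs <;> ring
      simp_rw [this, ← Finset.sum_div, Finset.sum_add_distrib]
      simp
      ring
    have e2 : ∑ x, ∑ y, (if G.Adj x y then (f x + f y) ^ 2 else 0) =
        2 * ∑ x, ((G.degree x : ℝ) * f x ^ 2 + ∑ y, if G.Adj x y then f x * f y else 0) := by
      have e3 : ∑ x, ∑ y, (if G.Adj x y then f y ^ 2 else 0) =
          ∑ x, ∑ y, (if G.Adj x y then f x ^ 2 else 0) := by
        rw [Finset.sum_comm]
        simp_rw [G.adj_comm]
      have e4 : ∀ x, (G.degree x : ℝ) * f x ^ 2 = ∑ y, if G.Adj x y then f x ^ 2 else 0 := by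
        intro x
        rw [hd, Finset.sum_mul]
        simp
      have e5 : ∀ x y, (if G.Adj x y then (f x + f y) ^ 2 else 0) =
          (if G.Adj x y then f x ^ 2 else 0) + (if G.Adj x y then f y ^ 2 else 0) +
          2 * (if G.Adj x y then f x * f y else 0) := by
        intro x y
        split_ifs <;> ring
      simp_rw [e5, e4, Finset.sum_add_distrib, e3, ← Finset.mul_sum]
      ring
    rw [form]
    simp_rw [e1]
    rw [← Finset.sum_div, ← Finset.sum_div, e2]
    ring
  rw [h]
  have : 0 ≤ ∑ x, ∑ y, if G.Adj x y then (f x + f y) ^ 2 else 0 :=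
    Finset.sum_nonneg fun x _ => Finset.sum_nonneg fun y _ => by split_ifs <;> positivity
  positivity

theorem form_flow_le (hG : G.Connected) {φ : V → ℝ} {a : V} (hφ : φ a = 0) :
    form (flow G) φ φ ≤ (1 - 1 / (tHit G).toReal) * ∑ x, stat G x * φ x ^ 2 := by
  have htop : ∀ x, expHit G x a ≠ ⊤ := fun x => expHit_ne_top G hG x a
  have hone : ∀ x, x ≠ a → (expHit G x a).toReal =
      1 + ∑ y, (lazyProb G x y).toReal * (expHit G y a).toReal := by
    intro x hx
    have hsum : ∀ y ∈ Finset.univ, lazyProb G x y * expHit G y a ≠ ⊤ := fun y _ =>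
      ENNReal.mul_ne_top (lazyProb_ne_top G x y) (htop y)
    rw [expHit_of_ne G hx, ENNReal.toReal_add (by simp) (ENNReal.sum_ne_top.2 hsum),
      ENNReal.toReal_sum hsum]
    simp
  refine form_le_of_supersolution (g := fun x => (expHit G x a).toReal) (flow_nonneg G)
    (flow_comm G) (stat_nonneg G) (fun _ => ENNReal.toReal_nonneg) ?_
    (fun x => ENNReal.toReal_mono (tHit_ne_top G hG) (expHit_le_tHit G x a)) ?_ hφ
  · intro x hx
    rw [hone x hx]
    have : 0 ≤ ∑ y, (lazyProb G x y).toReal * (expHit G y a).toReal :=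
      Finset.sum_nonneg fun _ _ => mul_nonneg ENNReal.toReal_nonneg ENNReal.toReal_nonneg
    linarith
  · intro x hx
    rw [hone x hx, mul_add, mul_one, Finset.mul_sum]
    simp [flow, mul_assoc]

variable {G} in
theorem sum_stat (hG : G.Connected) (hn : 1 < Fintype.card V) : ∑ u, stat G u = 1 := by
  simp only [stat]
  rw [← Finset.sum_div]
  refine div_self (ne_of_gt ?_)
  have : Nontrivial V := Fintype.one_lt_card_iff_nontrivial.1 hn
  obtain ⟨u⟩ : Nonempty V := inferInstance
  have hu : 0 < G.degree u := hG.preconnected.degree_pos_of_nontrivial u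
  exact Finset.sum_pos' (fun _ _ => Nat.cast_nonneg _) ⟨u, Finset.mem_univ u, by exact_mod_cast hu⟩

theorem one_le_tHit (hG : G.Connected) (hn : 1 < Fintype.card V) : 1 ≤ (tHit G).toReal := by
  obtain ⟨u, v, huv⟩ := Fintype.exists_pair_of_one_lt_card hn
  have h : 1 ≤ tHit G := by
    refine le_trans ?_ (expHit_le_tHit G u v)
    rw [expHit_of_ne G huv]
    exact le_self_add
  simpa using ENNReal.toReal_mono (tHit_ne_top G hG) h

/-! ### Avoiding stationary walks -/

/-- The law of each of the walks from `b j` is restricted to the vertices other than `a` and then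
moved by one step. -/
theorem sum_prod_mul_avoidProb_succ {k : ℕ} (β : V → ℝ≥0∞) (s : ℕ)
    (a : V) :
    ∑ b : Fin k → V, (∏ j, β (b j)) * avoidProb G (s + 1) a b =
      ∑ a', lazyProb G a a' * ∑ b' : Fin k → V,
        (∏ j, ∑ x, (if x = a then 0 else β x) * lazyProb G x (b' j)) * avoidProb G s a' b' := by
  have h1 : ∀ b : Fin k → V, (∏ j, β (b j)) * avoidProb G (s + 1) a b =
      ∑ a', ∑ b' : Fin k → V, lazyProb G a a' *
        ((∏ j, (if b j = a then 0 else β (b j)) * lazyProb G (b j) (b' j)) *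
          avoidProb G s a' b') := by
    intro b
    rw [avoidProb]
    split_ifs with h
    · obtain ⟨j, hj⟩ := h
      have h0 : ∀ b' : Fin k → V,
          ∏ j, (if b j = a then 0 else β (b j)) * lazyProb G (b j) (b' j) = 0 := fun b' =>
        Finset.prod_eq_zero (Finset.mem_univ j) (by simp [hj])
      simp only [h0, zero_mul, mul_zero, Finset.sum_const_zero]
    · push Not at h
      simp_rw [if_neg (h _), Finset.prod_mul_distrib, Finset.mul_sum]
      refine Finset.sum_congr rfl fun a' _ => Finset.sum_congr rfl fun b' _ => ?_
      ring
  simp_rw [h1]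
  rw [Finset.sum_comm]
  refine Finset.sum_congr rfl fun a' _ => ?_
  rw [Finset.sum_comm, Finset.mul_sum]
  refine Finset.sum_congr rfl fun b' _ => ?_
  rw [← Finset.mul_sum, ← Finset.sum_mul, Finset.prod_univ_sum, Fintype.piFinset_univ]

theorem sum_prod_mul_avoidProb_zero_le {k : ℕ} (β : V → ℝ≥0∞)
    (a : V) :
    ∑ b : Fin k → V, (∏ j, β (b j)) * avoidProb G 0 a b ≤
      (∑ x, if x = a then 0 else β x) ^ k := by
  rw [Fintype.sum_pow]
  refine Finset.sum_le_sum fun b _ => ?_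
  rw [avoidProb]
  split_ifs with h
  · simp
  · push Not at h
    simp [h]

/-- The law of each of the independent walks has density `P u` with respect to the stationary
distribution, where `P` is the transition operator. The quantity which contracts by the factor
`1 - 1 / tHit` in each step is the seminorm `√⟨u, P u⟩` of `u`. -/
theorem sum_prod_mul_avoidProb_le (hG : G.Connected) (hn : 1 < Fintype.card V) (k s : ℕ)
    (a : V) (u : V → ℝ) (hu : ∀ x, 0 ≤ u x) (R : ℝ)
    (hR : 0 ≤ R) (hE : form (flow G) u u ≤ R ^ 2) :
    ∑ b : Fin k → V, (∏ j, ENNReal.ofReal (∑ y, flow G (b j) y * u y)) * avoidProb G s a b ≤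
      ENNReal.ofReal ((1 - 1 / (tHit G).toReal) ^ s * R) ^ k := by
  have hH := one_le_tHit G hG hn
  set l : ℝ := 1 - 1 / (tHit G).toReal with hl
  have hl0 : 0 ≤ l := by
    have : 1 / (tHit G).toReal ≤ 1 := div_le_one_of_le₀ hH (by positivity)
    linarith
  have hl1 : l ≤ 1 := by
    have : 0 ≤ 1 / (tHit G).toReal := by positivity
    linarith
  have hcs := form_sq_le (flow_comm G) (form_flow_nonneg G)
  induction s generalizing a u R with
  | zero =>
    refine (sum_prod_mul_avoidProb_zero_le G
      (fun x => ENNReal.ofReal (∑ y, flow G x y * u y)) a).trans ?_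
    gcongr
    set f : V → ℝ := fun x => if x = a then 0 else 1
    have h1 : ∑ x, (if x = a then 0 else ENNReal.ofReal (∑ y, flow G x y * u y)) =
        ENNReal.ofReal (form (flow G) f u) := by
      rw [form, ENNReal.ofReal_sum_of_nonneg]
      · refine Finset.sum_congr rfl fun x _ => ?_
        by_cases hx : x = a <;> simp [f, hx]
      · intro x _
        refine Finset.sum_nonneg fun y _ => mul_nonneg (mul_nonneg ?_ (flow_nonneg G x y)) (hu y)
        simp only [f]
        split_ifs <;> norm_num
    rw [h1, pow_zero, one_mul]
    refine ENNReal.ofReal_le_ofReal (abs_le_of_sq_le_sq' ?_ hR).2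
    have hf : form (flow G) f f ≤ 1 := by
      refine (form_flow_le G hG (a := a) (by simp [f])).trans ?_
      rw [← hl]
      have h2 : ∑ x, stat G x * f x ^ 2 ≤ 1 := by
        rw [← sum_stat hG hn]
        refine Finset.sum_le_sum fun x _ => ?_
        have := stat_nonneg G x
        simp only [f]
        split_ifs <;> simp [this]
      have h3 : 0 ≤ ∑ x, stat G x * f x ^ 2 :=
        Finset.sum_nonneg fun x _ => mul_nonneg (stat_nonneg G x) (sq_nonneg _)
      exact mul_le_one₀ hl1 h3 h2
    calc form (flow G) f u ^ 2 ≤ form (flow G) f f * form (flow G) u u := hcs f u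
      _ ≤ 1 * R ^ 2 := mul_le_mul hf hE (form_flow_nonneg G u) zero_le_one
      _ = R ^ 2 := one_mul _
  | succ s ih =>
    set u' : V → ℝ := fun x => if x = a then 0 else ∑ y, (lazyProb G x y).toReal * u y with hu'
    have hu'0 : ∀ x, 0 ≤ u' x := fun x => by
      simp only [hu']
      split_ifs
      · exact le_rfl
      · exact Finset.sum_nonneg fun y _ => mul_nonneg ENNReal.toReal_nonneg (hu y)
    have hstat : ∀ x, stat G x * u' x = if x = a then 0 else ∑ y, flow G x y * u y := fun x => by
      simp only [hu', flow]
      split_ifs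
      · simp
      · rw [Finset.mul_sum]
        exact Finset.sum_congr rfl fun y _ => (mul_assoc _ _ _).symm
    have hnorm : ∑ x, stat G x * u' x ^ 2 = form (flow G) u' u := by
      rw [form]
      refine Finset.sum_congr rfl fun x _ => ?_
      have : stat G x * u' x ^ 2 = u' x * (stat G x * u' x) := by ring
      rw [this, hstat]
      by_cases hx : x = a
      · simp [hu', hx]
      · rw [if_neg hx, Finset.mul_sum]
        exact Finset.sum_congr rfl fun y _ => (mul_assoc _ _ _).symm
    -- `⟨u', P u'⟩ ≤ l ‖u'‖² = l ⟨u', P u⟩ ≤ l √⟨u', P u'⟩ √⟨u, P u⟩`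
    have hE' : form (flow G) u' u' ≤ (l * R) ^ 2 := by
      have h1 : form (flow G) u' u' ≤ l * form (flow G) u' u := by
        rw [← hnorm]
        exact form_flow_le G hG (if_pos rfl)
      have h2 := hcs u' u
      have h0 := form_flow_nonneg G u'
      have h3 : form (flow G) u' u' ^ 2 ≤ (l * R) ^ 2 * form (flow G) u' u' :=
        calc form (flow G) u' u' ^ 2 ≤ (l * form (flow G) u' u) ^ 2 := by gcongr
          _ = l ^ 2 * form (flow G) u' u ^ 2 := by ring
          _ ≤ l ^ 2 * (form (flow G) u' u' * R ^ 2) := by gcongr; exact h2.trans (by gcongr)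
          _ = _ := by ring
      rcases h0.eq_or_lt with h4 | h4
      · rw [← h4]; positivity
      · exact le_of_mul_le_mul_right (by rwa [pow_two] at h3) h4
    have hβ : ∀ c, ∑ x, (if x = a then 0 else ENNReal.ofReal (∑ y, flow G x y * u y)) *
        lazyProb G x c = ENNReal.ofReal (∑ x, flow G c x * u' x) := by
      intro c
      rw [ENNReal.ofReal_sum_of_nonneg fun x _ => mul_nonneg (flow_nonneg G c x) (hu'0 x)]
      refine Finset.sum_congr rfl fun x _ => ?_
      have h1 : flow G c x * u' x = stat G x * u' x * (lazyProb G x c).toReal := by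
        rw [flow_comm, flow]; ring
      rw [h1, hstat, ENNReal.ofReal_mul' ENNReal.toReal_nonneg,
        ENNReal.ofReal_toReal (lazyProb_ne_top G x c)]
      by_cases hx : x = a <;> simp [hx]
    rw [sum_prod_mul_avoidProb_succ G fun x => ENNReal.ofReal (∑ y, flow G x y * u y)]
    simp_rw [hβ]
    calc _ ≤ ∑ a', lazyProb G a a' * ENNReal.ofReal (l ^ s * (l * R)) ^ k := by
          gcongr with a' _
          exact ih a' u' hu'0 (l * R) (mul_nonneg hl0 hR) hE'
      _ = _ := by
          rw [← Finset.sum_mul, sum_lazyProb, one_mul, ← mul_assoc, ← pow_succ]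

/-! ### The number of walks left -/

/-- After `t` steps more than `k` walks are left with probability at most
`n (1 - 1 / tHit) ^ (t k)`. -/
theorem measure_lt_card_coalescing_le_mul_pow (hG : G.Connected) (hn : 1 < Fintype.card V)
    (k t : ℕ) :
    stepMeasure G {ω | k < (coalescing ω Finset.univ t).card} ≤
      Fintype.card V * ENNReal.ofReal ((1 - 1 / (tHit G).toReal) ^ t) ^ k := by
  have hone : ∑ b : Fin k → V, ∏ j, ENNReal.ofReal (stat G (b j)) = 1 := by
    have h := Fintype.sum_pow (fun x => ENNReal.ofReal (stat G x)) k
    rw [← h, ← ENNReal.ofReal_sum_of_nonneg fun x _ => stat_nonneg G x, sum_stat hG hn]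
    simp
  have hE : form (flow G) (fun _ => 1) (fun _ => 1) ≤ 1 ^ 2 := by
    simp [form, sum_flow, sum_stat hG hn]
  calc stepMeasure G {ω | k < (coalescing ω Finset.univ t).card}
      = ∑ b : Fin k → V, (∏ j, ENNReal.ofReal (stat G (b j))) *
          stepMeasure G {ω | k < (coalescing ω Finset.univ t).card} := by
        rw [← Finset.sum_mul, hone, one_mul]
    _ ≤ ∑ b : Fin k → V, (∏ j, ENNReal.ofReal (stat G (b j))) * ∑ a, avoidProb G t a b := by
        gcongr
        exact measure_lt_card_coalescing_le G k t _
    _ = ∑ a, ∑ b : Fin k → V, (∏ j, ENNReal.ofReal (stat G (b j))) * avoidProb G t a b := by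
        simp_rw [Finset.mul_sum]
        exact Finset.sum_comm
    _ ≤ ∑ _a : V, ENNReal.ofReal ((1 - 1 / (tHit G).toReal) ^ t) ^ k := by
        refine Finset.sum_le_sum fun a _ => ?_
        have h := sum_prod_mul_avoidProb_le G hG hn k t a (fun _ => 1)
          (fun _ => zero_le_one) 1 zero_le_one hE
        simpa only [mul_one, sum_flow] using h
    _ = _ := by simp

theorem card_mul_pow_le {n H : ℝ} {t k : ℕ} (hn : 0 < n) (hH : 1 ≤ H) (ht : H ≤ t)
    (hk : 2 * Real.log n ≤ k) : n * ((1 - 1 / H) ^ t) ^ k ≤ 1 / n := by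
  have h0 : 0 ≤ 1 - 1 / H := by
    have : 1 / H ≤ 1 := div_le_one_of_le₀ hH (by positivity)
    linarith
  have h1 : (1 - 1 / H) ^ t ≤ Real.exp (-1) :=
    calc (1 - 1 / H) ^ t ≤ Real.exp (-(1 / H)) ^ t := by
          gcongr
          exact Real.one_sub_le_exp_neg _
      _ = Real.exp (-(t / H)) := by rw [← Real.exp_nat_mul]; ring_nf
      _ ≤ Real.exp (-1) := by
          gcongr
          rwa [one_le_div (by positivity)]
  calc n * ((1 - 1 / H) ^ t) ^ k ≤ n * Real.exp (-1) ^ k := by gcongr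
    _ = n * Real.exp (-k) := by rw [← Real.exp_nat_mul]; ring_nf
    _ ≤ n * Real.exp (-(2 * Real.log n)) := by gcongr
    _ = 1 / n := by
        rw [Real.exp_neg, two_mul, Real.exp_add, Real.exp_log hn]
        field_simp

end CoalescingWalks

theorem theorem4p3 :
    ∃ C K : ℝ, 0 < C ∧ 0 < K ∧
      ∀ (V : Type*) [Fintype V] [DecidableEq V] [MeasurableSpace V] [DiscreteMeasurableSpace V]
        (G : SimpleGraph V) [DecidableRel G.Adj], G.Connected →
        CoalescingWalks.tHit G ≠ ⊤ ∧
        ∀ t : ℕ, C * (CoalescingWalks.tHit G).toReal ≤ (t : ℝ) →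
          1 - 1 / (Fintype.card V : ℝ) ≤
            (CoalescingWalks.stepMeasure G).real
              {ω | ((CoalescingWalks.coalescing ω Finset.univ t).card : ℝ) ≤
                K * Real.log (Fintype.card V) ^ 3} := by
  refine ⟨1, 10, one_pos, by norm_num, fun V _ _ _ _ G _ hG =>
    ⟨CoalescingWalks.tHit_ne_top G hG, fun t ht => ?_⟩⟩
  have : Nonempty V := hG.nonempty
  rcases (Nat.succ_le_of_lt (Fintype.card_pos (α := V))).eq_or_lt with h1 | hn
  · -- For a single vertex the asserted probability bound is `0`.
    rw [← h1]
    simp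
  set k := ⌈2 * Real.log (Fintype.card V)⌉₊
  have hk : 2 * Real.log (Fintype.card V) ≤ k := Nat.le_ceil _
  have hn2 : (2 : ℝ) ≤ Fintype.card V := by exact_mod_cast hn
  have hlog : 0.69 ≤ Real.log (Fintype.card V) :=
    (by linarith [Real.log_two_gt_d9] : (0.69 : ℝ) ≤ Real.log 2).trans
      (Real.log_le_log (by norm_num) hn2)
  have hkK : (k : ℝ) ≤ 10 * Real.log (Fintype.card V) ^ 3 := by
    have h2 : (k : ℝ) < 2 * Real.log (Fintype.card V) + 1 := Nat.ceil_lt_add_one (by linarith)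
    have h3 : 0.476 ≤ Real.log (Fintype.card V) ^ 2 := by nlinarith
    nlinarith
  rw [one_mul] at ht
  have hfew := CoalescingWalks.measure_lt_card_coalescing_le_mul_pow G hG hn k t
  have hH := CoalescingWalks.one_le_tHit G hG hn
  have hbad : (CoalescingWalks.stepMeasure G).real
      {ω | k < (CoalescingWalks.coalescing ω Finset.univ t).card} ≤ 1 / (Fintype.card V : ℝ) := by
    refine le_trans ?_ (CoalescingWalks.card_mul_pow_le (by positivity) hH ht hk)
    have h0 : 0 ≤ 1 - 1 / (CoalescingWalks.tHit G).toReal := by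
      have : 1 / (CoalescingWalks.tHit G).toReal ≤ 1 := div_le_one_of_le₀ hH (by positivity)
      linarith
    refine (ENNReal.toReal_mono (by finiteness) hfew).trans (le_of_eq ?_)
    rw [ENNReal.toReal_mul, ENNReal.toReal_pow, ENNReal.toReal_ofReal (by positivity)]
    simp
  have hcover : (Set.univ : Set (ℕ × V → V)) ⊆
      {ω | ((CoalescingWalks.coalescing ω Finset.univ t).card : ℝ) ≤
        10 * Real.log (Fintype.card V) ^ 3} ∪
      {ω | k < (CoalescingWalks.coalescing ω Finset.univ t).card} := by
    intro ω _
    rcases le_or_gt (CoalescingWalks.coalescing ω Finset.univ t).card k with h | h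
    · exact Or.inl ((Nat.cast_le.2 h).trans hkK)
    · exact Or.inr h
  have hle := (measureReal_mono (μ := CoalescingWalks.stepMeasure G) hcover).trans
    (measureReal_union_le _ _)
  rw [probReal_univ] at hle
  linarith
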